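/- A (2-valued) Chu space is a triple $\langle X,r,A\rangle$ of two sets $X$ (points), $A$ (states), possibly empty, and a relation $r\subseteq X\times A$. It is viewed as a two-sorted structure for the language that has variables $v^{\mathsf p}$ for points, variables $v^{\mathsf s}$ for states, equality in each sort, and one binary relation symbol $R(v^{\mathsf p},v^{\mathsf s})$, interpreted by $r$. First-order formulas of this language ($\mathcal L^{\mathrm{II}}_{\omega,\omega}$-formulas) are built from the atomic formulas $v^{\mathsf p}_0=v^{\mathsf p}_1$, $v^{\mathsf s}_0=v^{\mathsf s}_1$ and $R(v^{\mathsf p},v^{\mathsf s})$ by negation, finite conjunctions and disjunctions, and existential and universal quantification over points and over states; a sentence is a formula without free variables, and two sentences are logically equivalent if they hold in the same Chu spaces. A first-order sentence $\varphi$ is regressive if it is preserved under restrictions in the second sort: for every Chu space $\langle X,r,A\rangle$ and every $B\subseteq A$, if $\varphi$ holds in $\langle X,r,A\rangle$, then $\varphi$ holds in $\langle X,r\cap(X\times B),B\rangle$. (For example, if $\tau'\subseteq\tau$ are topologies on $X$, then $\langle X,\in,\tau'\rangle$ is a restriction of $\langle X,\in,\tau\rangle$ in the second sort.) The first-order regressive-flow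 formulas are the formulas that are built from atomic formulas and negated atomic formulas by finite conjunctions and disjunctions, existential and universal quantification over points, and universal quantification over states. Theorem. A first-order two-sorted sentence is regressive if and only if it is logically equivalent to a first-order regressive-flow sentence. -/

import Mathlib

universe u

namespace Chu

/-- A (2-valued) Chu space `⟨X, r, A⟩`: a type of points, a type of states and a binary relation
between them. Either sort may be empty. -/
structure ChuSpace where
  Point : Type u
  State : Type u
  rel : Point → State → Prop

/-- A Chu transform from `⟨X, r, A⟩` to `⟨Y, s, B⟩`: an adjoint pair `f : X → Y`, `g : B → A`. -/
structure ChuTransform (C D : ChuSpace.{u}) where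
  onPoint : C.Point → D.Point
  onState : D.State → C.State
  adjoint : ∀ (x : C.Point) (b : D.State), C.rel x (onState b) ↔ D.rel (onPoint x) b

/-- The Chu space `⟨X, r ∩ (X × B), B⟩` for a set `B ⊆ A` of states of `⟨X, r, A⟩`. -/
def ChuSpace.restrict (C : ChuSpace.{u}) (B : Set C.State) : ChuSpace.{u} where
  Point := C.Point
  State := B
  rel x b := C.rel x b

/-- The Chu transform from `⟨X, r, A⟩` to `⟨X, r ∩ (X × B), B⟩` that consists of the identity on
points and of the inclusion `B ⊆ A` on states. -/
def ChuTransform.restrict (C : ChuSpace.{u}) (B : Set C.State) :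
    ChuTransform C (C.restrict B) where
  onPoint := id
  onState := Subtype.val
  adjoint _ _ := Iff.rfl

/-- A Chu transform `(f, g)` from `⟨X, r, A⟩` to `⟨Y, s, B⟩` is a restriction in the second sort:
`X = Y`, `B ⊆ A`, `f` is the identity of `X` and `g` is the identity of `B` (as a map into `A`). -/
inductive ChuTransform.IsRestriction : ∀ {C D : ChuSpace.{u}}, ChuTransform C D → Prop
  | restrict (C : ChuSpace.{u}) (B : Set C.State) : IsRestriction (ChuTransform.restrict C B)

/-- First-order formulas of the two-sorted language with one relation symbol `R` between points and
states and with equality in each sort. `Formula m n` is the type of the formulas whose free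
variables are among `m` point variables and `n` state variables. Conjunctions and disjunctions are
those of finite (possibly empty) families, and a quantifier over a finite tuple is an iteration of
the quantifiers over one variable; a quantifier binds the last variable of its sort. -/
inductive Formula : ℕ → ℕ → Type
  | eqPoint {m n : ℕ} (i j : Fin m) : Formula m n
  | eqState {m n : ℕ} (i j : Fin n) : Formula m n
  | rel {m n : ℕ} (i : Fin m) (j : Fin n) : Formula m n
  | neg {m n : ℕ} (φ : Formula m n) : Formula m n
  | conj {m n k : ℕ} (φ : Fin k → Formula m n) : Formula m n
  | disj {m n k : ℕ} (φ : Fin k → Formula m n) : Formula m n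
  | exPoint {m n : ℕ} (φ : Formula (m + 1) n) : Formula m n
  | allPoint {m n : ℕ} (φ : Formula (m + 1) n) : Formula m n
  | exState {m n : ℕ} (φ : Formula m (n + 1)) : Formula m n
  | allState {m n : ℕ} (φ : Formula m (n + 1)) : Formula m n

/-- A sentence is a formula without free variables. -/
abbrev Sentence : Type := Formula 0 0

namespace Formula

/-- `φ.Realize C x a` means that the formula `φ` holds in the Chu space `C` when its free point
variables are interpreted by the tuple `x` and its free state variables by the tuple `a`. -/
def Realize (C : ChuSpace.{u}) :
    ∀ {m n : ℕ}, Formula m n → (Fin m → C.Point) → (Fin n → C.State) → Prop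
  | _, _, eqPoint i j, x, _ => x i = x j
  | _, _, eqState i j, _, a => a i = a j
  | _, _, rel i j, x, a => C.rel (x i) (a j)
  | _, _, neg φ, x, a => ¬ Realize C φ x a
  | _, _, conj φ, x, a => ∀ l, Realize C (φ l) x a
  | _, _, disj φ, x, a => ∃ l, Realize C (φ l) x a
  | _, _, exPoint φ, x, a => ∃ y : C.Point, Realize C φ (Fin.snoc x y) a
  | _, _, allPoint φ, x, a => ∀ y : C.Point, Realize C φ (Fin.snoc x y) a
  | _, _, exState φ, x, a => ∃ b : C.State, Realize C φ x (Fin.snoc a b)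
  | _, _, allState φ, x, a => ∀ b : C.State, Realize C φ x (Fin.snoc a b)

/-- The formula `φ` is preserved under the Chu transforms `(f, g)` that satisfy `P`: if `φ` holds of
`x` and `g(b)` in the domain, then it holds of `f(x)` and `b` in the codomain. -/
def PreservedUnder (P : ∀ {C D : ChuSpace.{u}}, ChuTransform C D → Prop) {m n : ℕ}
    (φ : Formula m n) : Prop :=
  ∀ (C D : ChuSpace.{u}) (t : ChuTransform C D), P t →
    ∀ (x : Fin m → C.Point) (b : Fin n → D.State),
      φ.Realize C x (t.onState ∘ b) → φ.Realize D (t.onPoint ∘ x) b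

/-- The (first-order) regressive-flow formulas: those built from atomic formulas and negated atomic
formulas by finite conjunctions and disjunctions, both quantifiers over points, and the universal
quantifier over states. -/
inductive IsRegressiveFlow : ∀ {m n : ℕ}, Formula m n → Prop
  | eqPoint {m n : ℕ} (i j : Fin m) : IsRegressiveFlow (eqPoint i j : Formula m n)
  | negEqPoint {m n : ℕ} (i j : Fin m) : IsRegressiveFlow (neg (eqPoint i j) : Formula m n)
  | eqState {m n : ℕ} (i j : Fin n) : IsRegressiveFlow (eqState i j : Formula m n)
  | negEqState {m n : ℕ} (i j : Fin n) : IsRegressiveFlow (neg (eqState i j) : Formula m n)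
  | rel {m n : ℕ} (i : Fin m) (j : Fin n) : IsRegressiveFlow (rel i j : Formula m n)
  | negRel {m n : ℕ} (i : Fin m) (j : Fin n) : IsRegressiveFlow (neg (rel i j) : Formula m n)
  | conj {m n k : ℕ} (φ : Fin k → Formula m n) (h : ∀ l, IsRegressiveFlow (φ l)) :
      IsRegressiveFlow (conj φ)
  | disj {m n k : ℕ} (φ : Fin k → Formula m n) (h : ∀ l, IsRegressiveFlow (φ l)) :
      IsRegressiveFlow (disj φ)
  | exPoint {m n : ℕ} (φ : Formula (m + 1) n) (h : IsRegressiveFlow φ) :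
      IsRegressiveFlow (exPoint φ)
  | allPoint {m n : ℕ} (φ : Formula (m + 1) n) (h : IsRegressiveFlow φ) :
      IsRegressiveFlow (allPoint φ)
  | allState {m n : ℕ} (φ : Formula m (n + 1)) (h : IsRegressiveFlow φ) :
      IsRegressiveFlow (allState φ)

end Formula

namespace Sentence

/-- The sentence `φ` holds in the Chu space `C`. -/
def HoldsIn (φ : Sentence) (C : ChuSpace.{u}) : Prop :=
  Formula.Realize C φ Fin.elim0 Fin.elim0

/-- A sentence is regressive if it is preserved under restrictions in the second sort. -/
def IsRegressive (φ : Sentence) : Prop :=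
  Formula.PreservedUnder.{u} ChuTransform.IsRestriction φ

/-- Two sentences are logically equivalent if they hold in the same Chu spaces. -/
def LogicallyEquivalent (φ θ : Sentence) : Prop :=
  ∀ C : ChuSpace.{u}, HoldsIn φ C ↔ HoldsIn θ C

end Sentence

end Chu

/-! A restriction deletes states and keeps all points. Of all ways to build formulas in negation
normal form, only the existential state quantifier can therefore fail to be preserved, its witness
being deleted; this is `IsRegressiveFlow.realize_restrict`.

For the converse, suppose that no regressive-flow sentence separates `φ` from its negation. A Henkin
construction then builds a Chu space satisfying `φ` together with a restriction of it violating `φ`.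
Its conditions are pairs of classes of pointed Chu spaces, left for the domain and right for the
restriction, that no regressive-flow formula in the shared names separates. Every witness can be
added without creating a separator. If `θ` separated the enlarged pair, then the old pair would be
separated by `∃ θ` for a left point, by `∀ θ` for a right point or a right state, and by `θ` itself
for a left state, which gets a name that exists on the left only. Thus an existential state
quantifier is never needed. Deciding a formula is similar, with a disjunction of two separators on
the left and a conjunction on the right.

As there are countably many formulas, a generic increasing sequence of conditions decides all of
them on both sides, with witnesses (`Condition.exists_generic`), so each side is described by a term
model. Literals and their negations are regressive-flow, hence the sides agree on literals in shared
names (`forces_left_iff_right`). So the right model is the left one restricted to the states with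
shared names. -/

namespace Chu

/-! ### Countability of the language and preservation under restriction -/

namespace Formula

/-- The height of the syntax tree of a formula. -/
def height : ∀ {m n : ℕ}, Formula m n → ℕ
  | _, _, eqPoint _ _ => 0
  | _, _, eqState _ _ => 0
  | _, _, rel _ _ => 0
  | _, _, neg φ => height φ + 1
  | _, _, conj φ => (Finset.univ.sup fun l => height (φ l)) + 1
  | _, _, disj φ => (Finset.univ.sup fun l => height (φ l)) + 1
  | _, _, exPoint φ => height φ + 1
  | _, _, allPoint φ => height φ + 1
  | _, _, exState φ => height φ + 1
  | _, _, allState φ => height φ + 1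

/-- The numbers of variables stay universally quantified in the induction because quantifiers change
them. Countability is what lets a sequence of length `ω` meet all demands. -/
theorem countable_height_lt (d : ℕ) :
    ∀ m n : ℕ, {ψ : Formula m n | ψ.height < d}.Countable := by
  induction d with
  | zero => intro m n; simp
  | succ d ih =>
    intro m n
    have hfam (k : ℕ) : {f : Fin k → Formula m n | ∀ l, f l ∈ {ψ | ψ.height < d}}.Countable :=
      Set.countable_pi fun _ => ih m n
    have hsup {k : ℕ} {f : Fin k → Formula m n}
        (h : (Finset.univ.sup fun l => (f l).height) < d) (l : Fin k) : (f l).height < d :=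
      (Finset.le_sup (f := fun l => (f l).height) (Finset.mem_univ l)).trans_lt h
    refine Set.Countable.mono (s₂ :=
      (Set.range fun p : Fin m × Fin m => (eqPoint p.1 p.2 : Formula m n)) ∪
      (Set.range fun p : Fin n × Fin n => (eqState p.1 p.2 : Formula m n)) ∪
      (Set.range fun p : Fin m × Fin n => (rel p.1 p.2 : Formula m n)) ∪
      neg '' {ψ | ψ.height < d} ∪
      (⋃ k, conj '' {f : Fin k → Formula m n | ∀ l, f l ∈ {ψ | ψ.height < d}}) ∪
      (⋃ k, disj '' {f : Fin k → Formula m n | ∀ l, f l ∈ {ψ | ψ.height < d}}) ∪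
      exPoint '' {ψ | ψ.height < d} ∪ allPoint '' {ψ | ψ.height < d} ∪
      exState '' {ψ | ψ.height < d} ∪ allState '' {ψ | ψ.height < d}) ?_ ?_
    · intro ψ hψ
      cases ψ with
      | conj f =>
        have := hsup (Nat.lt_of_succ_lt_succ hψ)
        simp only [Set.mem_union, Set.mem_iUnion]
        exact .inl <| .inl <| .inl <| .inl <| .inl <| .inr ⟨_, f, this, rfl⟩
      | disj f =>
        have := hsup (Nat.lt_of_succ_lt_succ hψ)
        simp only [Set.mem_union, Set.mem_iUnion]
        exact .inl <| .inl <| .inl <| .inl <| .inr ⟨_, f, this, rfl⟩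
      | _ => simp_all [height]
    · refine .union (.union (.union (.union (.union (.union (.union (.union (.union
        (Set.countable_range _) (Set.countable_range _)) (Set.countable_range _))
        ((ih _ _).image _)) (Set.countable_iUnion fun k => (hfam k).image _))
        (Set.countable_iUnion fun k => (hfam k).image _)) ((ih _ _).image _)) ((ih _ _).image _))
        ((ih _ _).image _)) ((ih _ _).image _)

instance countable {m n : ℕ} : Countable (Formula m n) := by
  rw [← Set.countable_univ_iff]
  refine (Set.countable_iUnion fun d => countable_height_lt d m n).mono fun ψ _ => ?_
  exact Set.mem_iUnion.2 ⟨ψ.height + 1, Nat.lt_succ_self _⟩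

/-- Literals transfer because the inclusion of `B` is injective and preserves and reflects the
relation. Points do not change, and a universal state quantifier only loses instances. -/
theorem IsRegressiveFlow.realize_restrict {C : ChuSpace.{u}} (B : Set C.State) {m n : ℕ}
    {θ : Formula m n} (hθ : θ.IsRegressiveFlow) (x : Fin m → C.Point) (b : Fin n → B)
    (h : θ.Realize C x (Subtype.val ∘ b)) : θ.Realize (C.restrict B) x b := by
  induction hθ with
  | eqPoint i j => exact h
  | negEqPoint i j => exact h
  | eqState i j => exact Subtype.ext h
  | negEqState i j => exact fun he => h (congrArg Subtype.val he)
  | rel i j => exact h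
  | negRel i j => exact h
  | conj φ _ ih => exact fun l => ih l x b (h l)
  | disj φ _ ih => exact h.imp fun l hl => ih l x b hl
  | exPoint φ _ ih => exact h.imp fun y hy => ih _ b hy
  | allPoint φ _ ih => exact fun y => ih _ b (h y)
  | allState φ _ ih =>
    exact fun s => ih x _ ((congrArg (φ.Realize C x)
      (Fin.comp_snoc (Subtype.val : B → C.State) b s)).mpr (h s.1))

end Formula

end Chu

/-! ### Pointed classes and names of elements -/

namespace Chu

/-- A class of Chu spaces with distinguished points, states and extra states, the latter two
being indexed separately. -/
structure PointedClass where
  points : ℕ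
  states : ℕ
  extras : ℕ
  Mem : ∀ C : ChuSpace.{u}, (Fin points → C.Point) → (Fin states → C.State) →
    (Fin extras → C.State) → Prop

/-- Index `inl j` names the `j`-th of `n` states, index `inr j` the `j`-th of `l` extra states. -/
def ValidIndex (n l : ℕ) : ℕ ⊕ ℕ → Prop
  | .inl j => j < n
  | .inr j => j < l

theorem ValidIndex.mono {n l n' l' : ℕ} (hn : n ≤ n') (hl : l ≤ l') :
    ∀ {j : ℕ ⊕ ℕ}, ValidIndex n l j → ValidIndex n' l' j
  | .inl _, h => lt_of_lt_of_le (b := n) h hn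
  | .inr _, h => lt_of_lt_of_le (b := l) h hl

/-- The state named by a valid index. -/
def lookup {α : Type*} {n l : ℕ} (a : Fin n → α) (c : Fin l → α) :
    ∀ j : ℕ ⊕ ℕ, ValidIndex n l j → α
  | .inl j, h => a ⟨j, h⟩
  | .inr j, h => c ⟨j, h⟩

theorem lookup_castLE {α : Type*} {n l n' l' : ℕ} (hn : n ≤ n') (hl : l ≤ l') (a : Fin n' → α)
    (c : Fin l' → α) (j : ℕ ⊕ ℕ) (h : ValidIndex n l j) :
    lookup (a ∘ Fin.castLE hn) (c ∘ Fin.castLE hl) j h = lookup a c j (h.mono hn hl) := by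
  cases j <;> rfl

theorem snoc_index {α : Type*} {k m : ℕ} (f : Fin k → ℕ) (hf : ∀ i, f i < m) (x : Fin m → α)
    (y : α) (h : ∀ i, (Fin.snoc f m : Fin (k + 1) → ℕ) i < m + 1) :
    (fun i => (Fin.snoc x y : Fin (m + 1) → α) ⟨(Fin.snoc f m : Fin (k + 1) → ℕ) i, h i⟩) =
      Fin.snoc (fun i => x ⟨f i, hf i⟩) y := by
  funext i
  refine Fin.lastCases ?_ (fun i => ?_) i
  · simp [Fin.snoc]
  · simp [Fin.snoc, hf i]

theorem snoc_index_lt {k m : ℕ} (f : Fin k → ℕ) (hf : ∀ i, f i < m) (i : Fin (k + 1)) :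
    (Fin.snoc f m : Fin (k + 1) → ℕ) i < m + 1 := by
  refine Fin.lastCases ?_ (fun i => ?_) i
  · simp
  · simpa using (hf i).trans (Nat.lt_succ_self m)

theorem snoc_lookup {α : Type*} {k n l n' l' : ℕ} (hn : n ≤ n') (hl : l ≤ l')
    (g : Fin k → ℕ ⊕ ℕ) (hg : ∀ i, ValidIndex n l (g i)) (j : ℕ ⊕ ℕ) (hj : ValidIndex n' l' j)
    (a : Fin n' → α) (c : Fin l' → α)
    (h : ∀ i, ValidIndex n' l' ((Fin.snoc g j : Fin (k + 1) → ℕ ⊕ ℕ) i)) :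
    (fun i => lookup a c ((Fin.snoc g j : Fin (k + 1) → ℕ ⊕ ℕ) i) (h i)) =
      Fin.snoc (fun i => lookup (a ∘ Fin.castLE hn) (c ∘ Fin.castLE hl) (g i) (hg i))
        (lookup a c j hj) := by
  funext i
  refine Fin.lastCases ?_ (fun i => ?_) i
  · simp
  · simp [lookup_castLE]

theorem snoc_valid {k n l n' l' : ℕ} (hn : n ≤ n') (hl : l ≤ l')
    (g : Fin k → ℕ ⊕ ℕ) (hg : ∀ i, ValidIndex n l (g i)) (j : ℕ ⊕ ℕ) (hj : ValidIndex n' l' j)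
    (i : Fin (k + 1)) : ValidIndex n' l' ((Fin.snoc g j : Fin (k + 1) → ℕ ⊕ ℕ) i) := by
  refine Fin.lastCases ?_ (fun i => ?_) i
  · simpa using hj
  · simpa using (hg i).mono hn hl

namespace PointedClass

/-- `σ ≤ τ` means that `τ` has at least as many distinguished elements as `σ` and that forgetting
the additional ones takes `τ` into `σ`. -/
instance : Preorder PointedClass.{u} where
  le σ τ := ∃ (hm : σ.points ≤ τ.points) (hn : σ.states ≤ τ.states) (hl : σ.extras ≤ τ.extras),
    ∀ C x a c, τ.Mem C x a c →
      σ.Mem C (x ∘ Fin.castLE hm) (a ∘ Fin.castLE hn) (c ∘ Fin.castLE hl)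
  le_refl _ := ⟨le_rfl, le_rfl, le_rfl, fun _ _ _ _ h => h⟩
  le_trans _ _ _ := fun ⟨hm, hn, hl, h⟩ ⟨hm', hn', hl', h'⟩ =>
    ⟨hm.trans hm', hn.trans hn', hl.trans hl', fun C _ _ _ hx => h C _ _ _ (h' C _ _ _ hx)⟩

/-- The indices in `f` and `g` name distinguished elements. -/
def InRange (σ : PointedClass.{u}) {k k' : ℕ} (f : Fin k → ℕ) (g : Fin k' → ℕ ⊕ ℕ) : Prop :=
  (∀ i, f i < σ.points) ∧ ∀ j, ValidIndex σ.states σ.extras (g j)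

/-- The formula `ψ` holds, throughout the class, of the elements named by `f` and `g`. -/
def Holds (σ : PointedClass.{u}) {k k' : ℕ} (ψ : Formula k k') (f : Fin k → ℕ)
    (g : Fin k' → ℕ ⊕ ℕ) : Prop :=
  ∃ h : σ.InRange f g, ∀ C x a c, σ.Mem C x a c →
    ψ.Realize C (fun i => x ⟨f i, h.1 i⟩) (fun j => lookup a c (g j) (h.2 j))

theorem InRange.mono {σ τ : PointedClass.{u}} (hle : σ ≤ τ) {k k' : ℕ} {f : Fin k → ℕ}
    {g : Fin k' → ℕ ⊕ ℕ} (h : σ.InRange f g) : τ.InRange f g :=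
  ⟨fun i => (h.1 i).trans_le hle.1, fun j => (h.2 j).mono hle.2.1 hle.2.2.1⟩

theorem Holds.mono {σ τ : PointedClass.{u}} (hle : σ ≤ τ) {k k' : ℕ} {ψ : Formula k k'}
    {f : Fin k → ℕ} {g : Fin k' → ℕ ⊕ ℕ} (h : σ.Holds ψ f g) : τ.Holds ψ f g := by
  obtain ⟨hr, h⟩ := h
  refine ⟨hr.mono hle, fun C x a c hx => ?_⟩
  obtain ⟨hm, hn, hl, hle⟩ := hle
  have := h C _ _ _ (hle C x a c hx)
  simp only [lookup_castLE] at this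
  exact this

/-- If `ψ` is existential, then some distinguished element is a witness for it. -/
def Witnessed (σ : PointedClass.{u}) :
    ∀ {k k' : ℕ}, Formula k k' → (Fin k → ℕ) → (Fin k' → ℕ ⊕ ℕ) → Prop
  | _, _, .exPoint ψ, f, g => ∃ i, σ.Holds ψ (Fin.snoc f i) g
  | _, _, .exState ψ, f, g => ∃ j, σ.Holds ψ f (Fin.snoc g j)
  | _, _, _, _, _ => True

/-- The class decides `ψ`, with a witness if `ψ` is existential and true. -/
def Settles (σ : PointedClass.{u}) {k k' : ℕ} (ψ : Formula k k') (f : Fin k → ℕ)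
    (g : Fin k' → ℕ ⊕ ℕ) : Prop :=
  σ.Holds ψ.neg f g ∨ σ.Holds ψ f g ∧ σ.Witnessed ψ f g

end PointedClass

/-- A pair of classes of pointed Chu spaces, the right one without extra states, that no
regressive-flow formula in the common distinguished elements separates. -/
structure Condition where
  points : ℕ
  states : ℕ
  extras : ℕ
  Left : ∀ C : ChuSpace.{u}, (Fin points → C.Point) → (Fin states → C.State) →
    (Fin extras → C.State) → Prop
  Right : ∀ C : ChuSpace.{u}, (Fin points → C.Point) → (Fin states → C.State) →
    (Fin 0 → C.State) → Prop
  inseparable : ∀ θ : Formula points states, θ.IsRegressiveFlow →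
    (∀ C x a c, Left C x a c → θ.Realize C x a) →
    (∀ C x a c, Right C x a c → ¬ θ.Realize C x a) → False

/-! ### Conditions, and deciding a formula on one side -/

namespace Condition

/-- The left (`true`) or right (`false`) class of a condition. -/
def side (p : Condition.{u}) : Bool → PointedClass.{u}
  | true => ⟨p.points, p.states, p.extras, p.Left⟩
  | false => ⟨p.points, p.states, 0, p.Right⟩

instance : Preorder Condition.{u} where
  le p q := ∀ s, p.side s ≤ q.side s
  le_refl _ _ := le_rfl
  le_trans _ _ _ h h' s := (h s).trans (h' s)

variable (p : Condition.{u}) {k k' : ℕ}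

theorem exists_left : ∃ C x a c, p.Left C x a c := by
  by_contra! h
  -- The empty disjunction is false everywhere, so it would separate an empty left class from the
  -- right one.
  exact p.inseparable (.disj (k := 0) Fin.elim0) (.disj _ fun l => l.elim0)
    (fun C x a c hx => (h C x a c hx).elim) fun C x a c _ ⟨l, _⟩ => l.elim0

theorem exists_right : ∃ C x a c, p.Right C x a c := by
  by_contra! h
  exact p.inseparable (.conj (k := 0) Fin.elim0) (.conj _ fun l => l.elim0)
    (fun C x a c _ l => l.elim0) fun C x a c hx => (h C x a c hx).elim

theorem exists_mem_side (s : Bool) : ∃ C x a c, (p.side s).Mem C x a c := by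
  cases s
  exacts [p.exists_right, p.exists_left]

/-- If neither half of the left class could be kept, each half would have a separator from the right
class, and the disjunction of the two would separate the condition itself. -/
theorem exists_decides_left (ψ : Formula k k') (f : Fin k → ℕ) (g : Fin k' → ℕ ⊕ ℕ)
    (h : (p.side true).InRange f g) :
    ∃ q ≥ p, (q.side true).Holds ψ.neg f g ∨ (q.side true).Holds ψ f g := by
  let P (C : ChuSpace.{u}) (x : Fin p.points → C.Point) (a : Fin p.states → C.State)
    (c : Fin p.extras → C.State) : Prop :=
    ψ.Realize C (fun i => x ⟨f i, h.1 i⟩) (fun j => lookup a c (g j) (h.2 j))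
  by_cases h₁ : ∃ θ : Formula p.points p.states, θ.IsRegressiveFlow ∧
      (∀ C x a c, p.Left C x a c ∧ ¬ P C x a c → θ.Realize C x a) ∧
      (∀ C x a c, p.Right C x a c → ¬ θ.Realize C x a)
  · by_cases h₂ : ∃ θ : Formula p.points p.states, θ.IsRegressiveFlow ∧
      (∀ C x a c, p.Left C x a c ∧ P C x a c → θ.Realize C x a) ∧
      (∀ C x a c, p.Right C x a c → ¬ θ.Realize C x a)
    · obtain ⟨θ₁, r₁, l₁, n₁⟩ := h₁
      obtain ⟨θ₂, r₂, l₂, n₂⟩ := h₂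
      refine (p.inseparable (.disj ![θ₁, θ₂]) (.disj _ ?_) ?_ ?_).elim
      · simp [Fin.forall_fin_two, r₁, r₂]
      · intro C x a c hx
        by_cases hP : P C x a c
        · exact ⟨1, l₂ C x a c ⟨hx, hP⟩⟩
        · exact ⟨0, l₁ C x a c ⟨hx, hP⟩⟩
      · intro C x a c hx
        simp only [Formula.Realize, Fin.exists_fin_two]
        exact fun hh => hh.elim (n₁ C x a c hx) (n₂ C x a c hx)
    · push Not at h₂
      refine ⟨⟨_, _, _, fun C x a c => p.Left C x a c ∧ P C x a c, p.Right, fun θ r l n =>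
        (h₂ θ r l).elim fun C ⟨x, a, c, hx, hh⟩ => n C x a c hx hh⟩, ?_, .inr ⟨h, ?_⟩⟩
      · rintro (_ | _)
        exacts [le_rfl, ⟨le_rfl, le_rfl, le_rfl, fun C x a c hx => hx.1⟩]
      · exact fun C x a c hx => hx.2
  · push Not at h₁
    refine ⟨⟨_, _, _, fun C x a c => p.Left C x a c ∧ ¬ P C x a c, p.Right, fun θ r l n =>
      (h₁ θ r l).elim fun C ⟨x, a, c, hx, hh⟩ => n C x a c hx hh⟩, ?_, .inl ⟨h, ?_⟩⟩
    · rintro (_ | _)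
      exacts [le_rfl, ⟨le_rfl, le_rfl, le_rfl, fun C x a c hx => hx.1⟩]
    · exact fun C x a c hx => hx.2

/-- Dual to the left case: separators for the two halves of the right class combine by conjunction.
-/
theorem exists_decides_right (ψ : Formula k k') (f : Fin k → ℕ) (g : Fin k' → ℕ ⊕ ℕ)
    (h : (p.side false).InRange f g) :
    ∃ q ≥ p, (q.side false).Holds ψ.neg f g ∨ (q.side false).Holds ψ f g := by
  let P (C : ChuSpace.{u}) (x : Fin p.points → C.Point) (a : Fin p.states → C.State)
    (c : Fin 0 → C.State) : Prop :=
    ψ.Realize C (fun i => x ⟨f i, h.1 i⟩) (fun j => lookup a c (g j) (h.2 j))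
  by_cases h₁ : ∃ θ : Formula p.points p.states, θ.IsRegressiveFlow ∧
      (∀ C x a c, p.Left C x a c → θ.Realize C x a) ∧
      (∀ C x a c, p.Right C x a c ∧ ¬ P C x a c → ¬ θ.Realize C x a)
  · by_cases h₂ : ∃ θ : Formula p.points p.states, θ.IsRegressiveFlow ∧
      (∀ C x a c, p.Left C x a c → θ.Realize C x a) ∧
      (∀ C x a c, p.Right C x a c ∧ P C x a c → ¬ θ.Realize C x a)
    · obtain ⟨θ₁, r₁, l₁, n₁⟩ := h₁
      obtain ⟨θ₂, r₂, l₂, n₂⟩ := h₂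
      refine (p.inseparable (.conj ![θ₁, θ₂]) (.conj _ ?_) ?_ ?_).elim
      · simp [Fin.forall_fin_two, r₁, r₂]
      · intro C x a c hx
        simp only [Formula.Realize, Fin.forall_fin_two]
        exact ⟨l₁ C x a c hx, l₂ C x a c hx⟩
      · intro C x a c hx hθ
        by_cases hP : P C x a c
        · exact n₂ C x a c ⟨hx, hP⟩ (hθ 1)
        · exact n₁ C x a c ⟨hx, hP⟩ (hθ 0)
    · push Not at h₂
      refine ⟨⟨_, _, _, p.Left, fun C x a c => p.Right C x a c ∧ P C x a c, fun θ r l n =>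
        (h₂ θ r l).elim fun C ⟨x, a, c, hx, hh⟩ => n C x a c hx hh⟩, ?_, .inr ⟨h, ?_⟩⟩
      · rintro (_ | _)
        exacts [⟨le_rfl, le_rfl, le_rfl, fun C x a c hx => hx.1⟩, le_rfl]
      · exact fun C x a c hx => hx.2
  · push Not at h₁
    refine ⟨⟨_, _, _, p.Left, fun C x a c => p.Right C x a c ∧ ¬ P C x a c, fun θ r l n =>
      (h₁ θ r l).elim fun C ⟨x, a, c, hx, hh⟩ => n C x a c hx hh⟩, ?_, .inl ⟨h, ?_⟩⟩
    · rintro (_ | _)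
      exacts [⟨le_rfl, le_rfl, le_rfl, fun C x a c hx => hx.1⟩, le_rfl]
    · exact fun C x a c hx => hx.2

end Condition

end Chu

/-! ### Adding witnesses; generic sequences -/

namespace Chu

theorem snoc_comp_castLE {α : Type*} {m : ℕ} (x : Fin m → α) (y : α) :
    (Fin.snoc x y : Fin (m + 1) → α) ∘ Fin.castLE (Nat.le_succ m) = x := by
  funext i
  exact Fin.snoc_castSucc (α := fun _ => α) y x i

namespace Condition

variable (p : Condition.{u}) {k k' : ℕ}

/-- The new name denotes a witness on the left and an arbitrary point on the right. A separator `θ`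
of the new pair would make `∃ θ` a separator of the old one. -/
theorem exists_point_witness_left (ψ : Formula (k + 1) k') (f : Fin k → ℕ)
    (g : Fin k' → ℕ ⊕ ℕ) (h : (p.side true).Holds ψ.exPoint f g) :
    ∃ q ≥ p, ∃ i, (q.side true).Holds ψ (Fin.snoc f i) g := by
  obtain ⟨hr, h⟩ := h
  have hr₁ (i) : f i < p.points := hr.1 i
  have hf := snoc_index_lt f hr₁
  have hg (j) : ValidIndex p.states p.extras (g j) := hr.2 j
  replace h (C x a c) (hx : p.Left C x a c) : ∃ y, ψ.Realize C
    (Fin.snoc (fun i => x ⟨f i, hr₁ i⟩) y) (fun j => lookup a c (g j) (hg j)) := h C x a c hx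
  refine ⟨⟨p.points + 1, p.states, p.extras, fun C x a c =>
      p.Left C (x ∘ Fin.castLE (Nat.le_succ _)) a c ∧
        ψ.Realize C (fun i => x ⟨_, hf i⟩) (fun j => lookup a c (g j) (hg j)),
      fun C x a c => p.Right C (x ∘ Fin.castLE (Nat.le_succ _)) a c, ?_⟩, ?_, p.points,
      ⟨hf, hg⟩, fun C x a c hx => hx.2⟩
  · intro θ r l n
    refine p.inseparable θ.exPoint (.exPoint _ r) ?_ ?_
    · intro C x a c hx
      obtain ⟨y, hy⟩ := h C x a c hx
      refine ⟨y, l C _ a c ⟨?_, ?_⟩⟩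
      · rwa [snoc_comp_castLE]
      · rw [snoc_index f hr₁]
        exact hy
    · rintro C x a c hx ⟨y, hy⟩
      exact n C _ a c (by rwa [snoc_comp_castLE]) hy
  · rintro (_ | _)
    exacts [⟨Nat.le_succ _, le_rfl, le_rfl, fun C x a c hx => hx⟩,
      ⟨Nat.le_succ _, le_rfl, le_rfl, fun C x a c hx => hx.1⟩]

/-- Here the left point is arbitrary and the right one is a witness, so a new separator is
quantified universally. -/
theorem exists_point_witness_right (ψ : Formula (k + 1) k') (f : Fin k → ℕ)
    (g : Fin k' → ℕ ⊕ ℕ) (h : (p.side false).Holds ψ.exPoint f g) :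
    ∃ q ≥ p, ∃ i, (q.side false).Holds ψ (Fin.snoc f i) g := by
  obtain ⟨hr, h⟩ := h
  have hr₁ (i) : f i < p.points := hr.1 i
  have hf := snoc_index_lt f hr₁
  have hg (j) : ValidIndex p.states 0 (g j) := hr.2 j
  replace h (C x a c) (hx : p.Right C x a c) : ∃ y, ψ.Realize C
    (Fin.snoc (fun i => x ⟨f i, hr₁ i⟩) y) (fun j => lookup a c (g j) (hg j)) := h C x a c hx
  refine ⟨⟨p.points + 1, p.states, p.extras,
      fun C x a c => p.Left C (x ∘ Fin.castLE (Nat.le_succ _)) a c,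
      fun C x a c => p.Right C (x ∘ Fin.castLE (Nat.le_succ _)) a c ∧
        ψ.Realize C (fun i => x ⟨_, hf i⟩) (fun j => lookup a c (g j) (hg j)), ?_⟩, ?_,
      p.points, ⟨hf, hg⟩, fun C x a c hx => hx.2⟩
  · intro θ r l n
    refine p.inseparable θ.allPoint (.allPoint _ r) ?_ ?_
    · intro C x a c hx y
      exact l C _ a c (by rwa [snoc_comp_castLE])
    · intro C x a c hx hθ
      obtain ⟨y, hy⟩ := h C x a c hx
      refine n C _ a c ⟨?_, ?_⟩ (hθ y)
      · rwa [snoc_comp_castLE]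
      · rw [snoc_index f hr₁]
        exact hy
  · rintro (_ | _)
    exacts [⟨Nat.le_succ _, le_rfl, le_rfl, fun C x a c hx => hx.1⟩,
      ⟨Nat.le_succ _, le_rfl, le_rfl, fun C x a c hx => hx⟩]

/-- The witness may be a state that the restriction deletes, so it becomes an extra state.
Separators cannot mention extra states, hence a new separator is already an old one. -/
theorem exists_state_witness_left (ψ : Formula k (k' + 1)) (f : Fin k → ℕ)
    (g : Fin k' → ℕ ⊕ ℕ) (h : (p.side true).Holds ψ.exState f g) :
    ∃ q ≥ p, ∃ j, (q.side true).Holds ψ f (Fin.snoc g j) := by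
  obtain ⟨hr, h⟩ := h
  have hf (i) : f i < p.points := hr.1 i
  have hr₂ (j) : ValidIndex p.states p.extras (g j) := hr.2 j
  replace h (C x a c) (hx : p.Left C x a c) : ∃ y, ψ.Realize C (fun i => x ⟨f i, hf i⟩)
    (Fin.snoc (fun j => lookup a c (g j) (hr₂ j)) y) := h C x a c hx
  have hj : ValidIndex p.states (p.extras + 1) (.inr p.extras) := Nat.lt_succ_self _
  have hg := snoc_valid le_rfl (Nat.le_succ _) g hr₂ _ hj
  refine ⟨⟨p.points, p.states, p.extras + 1, fun C x a c =>
      p.Left C x a (c ∘ Fin.castLE (Nat.le_succ _)) ∧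
        ψ.Realize C (fun i => x ⟨_, hf i⟩) (fun j => lookup a c _ (hg j)),
      p.Right, ?_⟩, ?_, .inr p.extras, ⟨hf, hg⟩, fun C x a c hx => hx.2⟩
  · intro θ r l n
    refine p.inseparable θ r ?_ n
    intro C x a c hx
    obtain ⟨y, hy⟩ := h C x a c hx
    refine l C x a (Fin.snoc c y) ⟨?_, ?_⟩
    · rwa [snoc_comp_castLE]
    · rw [snoc_lookup le_rfl (Nat.le_succ _) g hr₂ _ hj, snoc_comp_castLE]
      simpa [lookup, Fin.snoc] using hy
  · rintro (_ | _)
    exacts [le_rfl, ⟨le_rfl, le_rfl, Nat.le_succ _, fun C x a c hx => hx.1⟩]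

/-- A state of the restriction is also a state of the domain, so the name is shared and arbitrary on
the left. A new separator is quantified universally over states. -/
theorem exists_state_witness_right (ψ : Formula k (k' + 1)) (f : Fin k → ℕ)
    (g : Fin k' → ℕ ⊕ ℕ) (h : (p.side false).Holds ψ.exState f g) :
    ∃ q ≥ p, ∃ j, (q.side false).Holds ψ f (Fin.snoc g j) := by
  obtain ⟨hr, h⟩ := h
  have hf (i) : f i < p.points := hr.1 i
  have hr₂ (j) : ValidIndex p.states 0 (g j) := hr.2 j
  replace h (C x a c) (hx : p.Right C x a c) : ∃ y, ψ.Realize C (fun i => x ⟨f i, hf i⟩)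
    (Fin.snoc (fun j => lookup a c (g j) (hr₂ j)) y) := h C x a c hx
  have hj : ValidIndex (p.states + 1) 0 (.inl p.states) := Nat.lt_succ_self _
  have hg := snoc_valid (Nat.le_succ _) le_rfl g hr₂ _ hj
  refine ⟨⟨p.points, p.states + 1, p.extras,
      fun C x a c => p.Left C x (a ∘ Fin.castLE (Nat.le_succ _)) c,
      fun C x a c => p.Right C x (a ∘ Fin.castLE (Nat.le_succ _)) c ∧
        ψ.Realize C (fun i => x ⟨_, hf i⟩) (fun j => lookup a c _ (hg j)), ?_⟩, ?_,
      .inl p.states, ⟨hf, hg⟩, fun C x a c hx => hx.2⟩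
  · intro θ r l n
    refine p.inseparable θ.allState (.allState _ r) ?_ ?_
    · intro C x a c hx y
      exact l C _ _ c (by rwa [snoc_comp_castLE])
    · intro C x a c hx hθ
      obtain ⟨y, hy⟩ := h C x a c hx
      refine n C x (Fin.snoc a y) c ⟨?_, ?_⟩ (hθ y)
      · rwa [snoc_comp_castLE]
      · rw [snoc_lookup (Nat.le_succ _) le_rfl g hr₂ _ hj, snoc_comp_castLE]
        simpa [lookup, Fin.snoc] using hy
  · rintro (_ | _)
    exacts [⟨le_rfl, Nat.le_succ _, le_rfl, fun C x a c hx => hx.1⟩,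
      ⟨le_rfl, Nat.le_succ _, le_rfl, fun C x a c hx => hx⟩]

theorem exists_settles (s : Bool) (ψ : Formula k k') (f : Fin k → ℕ) (g : Fin k' → ℕ ⊕ ℕ)
    (h : (p.side s).InRange f g) : ∃ q ≥ p, (q.side s).Settles ψ f g := by
  obtain ⟨q, hq, h | h⟩ :
      ∃ q ≥ p, (q.side s).Holds ψ.neg f g ∨ (q.side s).Holds ψ f g := by
    cases s
    exacts [p.exists_decides_right ψ f g h, p.exists_decides_left ψ f g h]
  · exact ⟨q, hq, .inl h⟩
  · cases ψ with
    | exPoint ψ =>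
      obtain ⟨r, hr, hw⟩ : ∃ r ≥ q, ∃ i, (r.side s).Holds ψ (Fin.snoc f i) g := by
        cases s
        exacts [q.exists_point_witness_right ψ f g h, q.exists_point_witness_left ψ f g h]
      exact ⟨r, hq.trans hr, .inr ⟨h.mono (hr s), hw⟩⟩
    | exState ψ =>
      obtain ⟨r, hr, hw⟩ : ∃ r ≥ q, ∃ j, (r.side s).Holds ψ f (Fin.snoc g j) := by
        cases s
        exacts [q.exists_state_witness_right ψ f g h, q.exists_state_witness_left ψ f g h]
      exact ⟨r, hq.trans hr, .inr ⟨h.mono (hr s), hw⟩⟩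
    | _ => exact ⟨q, hq, .inr ⟨h, trivial⟩⟩

end Condition

/-- A form of the Rasiowa–Sikorski lemma: an increasing sequence from `p` along which each of
countably many demands `Q i` is met if its (persistent) precondition `P i` ever is. -/
theorem exists_generic_sequence {α ι : Type*} [Preorder α] [Countable ι] (P Q : ι → α → Prop)
    (mono : ∀ i a b, a ≤ b → P i a → P i b) (dense : ∀ i a, P i a → ∃ b ≥ a, Q i b) (p : α) :
    ∃ s : ℕ → α, Monotone s ∧ s 0 = p ∧ ∀ i N, P i (s N) → ∃ M, Q i (s M) := by
  have := Encodable.ofCountable ι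
  -- Demand `i` counts as handled once it is met or its precondition has become impossible at all
  -- later elements; this makes the set cofinal.
  let D (i : ι) : Order.Cofinal α :=
    ⟨{a | Q i a ∨ ∀ b ≥ a, ¬ P i b}, fun a => by
      by_cases h : ∃ b ≥ a, P i b
      · obtain ⟨b, hb, h⟩ := h
        obtain ⟨c, hc, h⟩ := dense i b h
        exact ⟨c, .inl h, hb.trans hc⟩
      · push Not at h
        exact ⟨a, .inr h, le_rfl⟩⟩
  have hm := Order.sequenceOfCofinals.monotone p D
  refine ⟨Order.sequenceOfCofinals p D, hm, rfl, fun i N hN => ?_⟩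
  rcases Order.sequenceOfCofinals.encode_mem p D i with h | h
  · exact ⟨_, h⟩
  · exact (h _ (hm (le_max_left _ N)) (mono i _ _ (hm (le_max_right _ N)) hN)).elim

/-- An increasing sequence of nonempty classes that settles every formula about the elements
it names. -/
structure IsGeneric (σ : ℕ → PointedClass.{u}) : Prop where
  mono : Monotone σ
  nonempty : ∀ N, ∃ C x a c, (σ N).Mem C x a c
  settles : ∀ {k k' : ℕ} (ψ : Formula k k') (f : Fin k → ℕ) (g : Fin k' → ℕ ⊕ ℕ) (N : ℕ),
    (σ N).InRange f g → ∃ M, (σ M).Settles ψ f g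

theorem Condition.exists_generic (p : Condition.{u}) :
    ∃ s : ℕ → Condition.{u}, Monotone s ∧ s 0 = p ∧
      ∀ b, IsGeneric fun N => (s N).side b := by
  let ι := Bool × Σ k : ℕ × ℕ, Formula k.1 k.2 × (Fin k.1 → ℕ) × (Fin k.2 → ℕ ⊕ ℕ)
  obtain ⟨s, hs, h0, h⟩ := exists_generic_sequence (ι := ι)
    (fun i q => (q.side i.1).InRange i.2.2.2.1 i.2.2.2.2)
    (fun i q => (q.side i.1).Settles i.2.2.1 i.2.2.2.1 i.2.2.2.2)
    (fun i a b hab ha => ha.mono (hab i.1))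
    (fun i a ha => a.exists_settles i.1 _ _ _ ha) p
  exact ⟨s, hs, h0, fun b => ⟨fun M N hMN => hs hMN b, fun N => (s N).exists_mem_side b,
    fun {k k'} ψ f g N hN => h ⟨b, ⟨k, k'⟩, ψ, f, g⟩ N hN⟩⟩

end Chu

/-! ### Forcing along a generic sequence, and the truth lemma -/

namespace Chu

variable {σ : ℕ → PointedClass.{u}} {k k' : ℕ}

/-- The formula `ψ` holds of the elements named by `f` and `g` in some class of the sequence. -/
def Forces (σ : ℕ → PointedClass.{u}) (ψ : Formula k k') (f : Fin k → ℕ)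
    (g : Fin k' → ℕ ⊕ ℕ) : Prop :=
  ∃ N, (σ N).Holds ψ f g

/-- The indices that name points in some class of the sequence. -/
abbrev PointName (σ : ℕ → PointedClass.{u}) : Type := {i : ℕ // ∃ N, i < (σ N).points}

/-- The indices that name states in some class of the sequence. -/
abbrev StateName (σ : ℕ → PointedClass.{u}) : Type :=
  {j : ℕ ⊕ ℕ // ∃ N, ValidIndex (σ N).states (σ N).extras j}

theorem exists_inRange (hσ : Monotone σ) (f : Fin k → PointName σ) (g : Fin k' → StateName σ) :
    ∃ N, (σ N).InRange (Subtype.val ∘ f) (Subtype.val ∘ g) := by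
  choose M hM using fun i => (f i).2
  choose M' hM' using fun j => (g j).2
  obtain ⟨B, hB⟩ := Finite.exists_le M
  obtain ⟨B', hB'⟩ := Finite.exists_le M'
  refine ⟨max B B', fun i => (hM i).trans_le ?_, fun j => (hM' j).mono ?_ ?_⟩
  · exact (hσ ((hB i).trans (le_max_left _ _))).1
  · exact (hσ ((hB' j).trans (le_max_right _ _))).2.1
  · exact (hσ ((hB' j).trans (le_max_right _ _))).2.2.1

namespace IsGeneric

variable (hσ : IsGeneric σ)
include hσ

/-- Finitely many premises hold together at a late enough stage. The stage `N` makes the names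
available even when there are no premises, so validities are forced. -/
theorem forces_of_imp {n : ℕ} {φ : Fin n → Formula k k'} {ψ : Formula k k'}
    {f : Fin k → PointName σ} {g : Fin k' → StateName σ}
    (h : ∀ l, Forces σ (φ l) (Subtype.val ∘ f) (Subtype.val ∘ g))
    (himp : ∀ (C : ChuSpace.{u}) x a, (∀ l, (φ l).Realize C x a) → ψ.Realize C x a) :
    Forces σ ψ (Subtype.val ∘ f) (Subtype.val ∘ g) := by
  choose M hM using h
  obtain ⟨B, hB⟩ := Finite.exists_le M
  obtain ⟨N, hN⟩ := exists_inRange hσ.mono f g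
  refine ⟨max B N, hN.mono (hσ.mono (le_max_right _ _)), fun C x a c hx => himp C _ _ fun l => ?_⟩
  exact ((hM l).mono (hσ.mono ((hB l).trans (le_max_left _ N)))).2 C x a c hx

theorem not_forces_neg {ψ : Formula k k'} {f : Fin k → ℕ} {g : Fin k' → ℕ ⊕ ℕ}
    (h : Forces σ ψ f g) : ¬ Forces σ ψ.neg f g := by
  rintro ⟨N', h'⟩
  obtain ⟨N, h⟩ := h
  obtain ⟨C, x, a, c, hx⟩ := hσ.nonempty (max N N')
  exact (h'.mono (hσ.mono (le_max_right _ _))).2 C x a c hx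
    ((h.mono (hσ.mono (le_max_left _ _))).2 C x a c hx)

theorem forces_neg (ψ : Formula k k') (f : Fin k → PointName σ) (g : Fin k' → StateName σ) :
    Forces σ ψ.neg (Subtype.val ∘ f) (Subtype.val ∘ g) ↔
      ¬ Forces σ ψ (Subtype.val ∘ f) (Subtype.val ∘ g) := by
  refine ⟨fun h h' => hσ.not_forces_neg h' h, fun h => ?_⟩
  obtain ⟨N, hN⟩ := exists_inRange hσ.mono f g
  obtain ⟨M, hM | hM⟩ := hσ.settles ψ _ _ N hN
  exacts [⟨M, hM⟩, (h ⟨M, hM.1⟩).elim]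

theorem forces_congr {φ ψ : Formula k k'} (f : Fin k → PointName σ) (g : Fin k' → StateName σ)
    (h : ∀ (C : ChuSpace.{u}) x a, φ.Realize C x a ↔ ψ.Realize C x a) :
    Forces σ φ (Subtype.val ∘ f) (Subtype.val ∘ g) ↔
      Forces σ ψ (Subtype.val ∘ f) (Subtype.val ∘ g) :=
  ⟨fun hφ => hσ.forces_of_imp (φ := fun _ : Fin 1 => φ) (fun _ => hφ)
    fun C x a h' => (h C x a).1 (h' 0),
  fun hψ => hσ.forces_of_imp (φ := fun _ : Fin 1 => ψ) (fun _ => hψ)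
    fun C x a h' => (h C x a).2 (h' 0)⟩

theorem forces_conj {n : ℕ} (φ : Fin n → Formula k k') (f : Fin k → PointName σ)
    (g : Fin k' → StateName σ) :
    Forces σ (.conj φ) (Subtype.val ∘ f) (Subtype.val ∘ g) ↔
      ∀ l, Forces σ (φ l) (Subtype.val ∘ f) (Subtype.val ∘ g) :=
  ⟨fun h l => hσ.forces_of_imp (φ := fun _ : Fin 1 => .conj φ) (fun _ => h)
    fun _ _ _ h' => h' 0 l, fun h => hσ.forces_of_imp h fun _ _ _ h' => h'⟩

/-- The members of one class may satisfy different disjuncts; that a single one is forced rests on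
`forces_neg`, through De Morgan. -/
theorem forces_disj {n : ℕ} (φ : Fin n → Formula k k') (f : Fin k → PointName σ)
    (g : Fin k' → StateName σ) :
    Forces σ (.disj φ) (Subtype.val ∘ f) (Subtype.val ∘ g) ↔
      ∃ l, Forces σ (φ l) (Subtype.val ∘ f) (Subtype.val ∘ g) := by
  rw [hσ.forces_congr (ψ := .neg (.conj fun l => .neg (φ l))) f g (by simp [Formula.Realize]),
    hσ.forces_neg, hσ.forces_conj]
  simp [hσ.forces_neg]

theorem forces_exPoint (ψ : Formula (k + 1) k') (f : Fin k → PointName σ)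
    (g : Fin k' → StateName σ) :
    Forces σ ψ.exPoint (Subtype.val ∘ f) (Subtype.val ∘ g) ↔
      ∃ i : PointName σ, Forces σ ψ (Subtype.val ∘ (Fin.snoc f i : Fin (k + 1) → PointName σ))
        (Subtype.val ∘ g) := by
  simp only [Fin.comp_snoc]
  constructor
  · rintro ⟨N, h⟩
    -- The formula is settled, and its negation is excluded by consistency, so a named witness is
    -- available.
    obtain ⟨M, hM | ⟨-, i, hM⟩⟩ := hσ.settles ψ.exPoint _ _ N h.1
    · exact (hσ.not_forces_neg ⟨N, h⟩ ⟨M, hM⟩).elim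
    · exact ⟨⟨i, M, by simpa using hM.1.1 (Fin.last k)⟩, M, hM⟩
  · rintro ⟨i, N, hr, h⟩
    refine ⟨N, ⟨fun l => by simpa using hr.1 l.castSucc, hr.2⟩, fun C x a c hx =>
      ⟨x ⟨i, by simpa using hr.1 (Fin.last k)⟩, ?_⟩⟩
    convert h C x a c hx using 1
    funext l
    refine Fin.lastCases ?_ (fun l => ?_) l <;> simp

theorem forces_exState (ψ : Formula k (k' + 1)) (f : Fin k → PointName σ)
    (g : Fin k' → StateName σ) :
    Forces σ ψ.exState (Subtype.val ∘ f) (Subtype.val ∘ g) ↔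
      ∃ j : StateName σ, Forces σ ψ (Subtype.val ∘ f)
        (Subtype.val ∘ (Fin.snoc g j : Fin (k' + 1) → StateName σ)) := by
  simp only [Fin.comp_snoc]
  constructor
  · rintro ⟨N, h⟩
    obtain ⟨M, hM | ⟨-, j, hM⟩⟩ := hσ.settles ψ.exState _ _ N h.1
    · exact (hσ.not_forces_neg ⟨N, h⟩ ⟨M, hM⟩).elim
    · exact ⟨⟨j, M, by simpa using hM.1.2 (Fin.last k')⟩, M, hM⟩
  · rintro ⟨j, N, hr, h⟩
    refine ⟨N, ⟨hr.1, fun l => by simpa using hr.2 l.castSucc⟩, fun C x a c hx =>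
      ⟨lookup a c j.1 (by simpa using hr.2 (Fin.last k')), ?_⟩⟩
    convert h C x a c hx using 1
    funext l
    refine Fin.lastCases ?_ (fun l => ?_) l <;> simp

end IsGeneric

/-- The point names `i` and `j` are forced to be equal. -/
def EqPointName (σ : ℕ → PointedClass.{u}) (i j : ℕ) : Prop :=
  Forces σ (.eqPoint 0 1 : Formula 2 0) ![i, j] Fin.elim0

/-- The state names `i` and `j` are forced to be equal. -/
def EqStateName (σ : ℕ → PointedClass.{u}) (i j : ℕ ⊕ ℕ) : Prop :=
  Forces σ (.eqState 0 1 : Formula 0 2) Fin.elim0 ![i, j]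

/-- The point name `i` and the state name `j` are forced to be related. -/
def RelName (σ : ℕ → PointedClass.{u}) (i : ℕ) (j : ℕ ⊕ ℕ) : Prop :=
  Forces σ (.rel 0 0 : Formula 1 1) ![i] ![j]

namespace IsGeneric

variable (hσ : IsGeneric σ)
include hσ

theorem forces_eqPoint (i j : Fin k) (f : Fin k → PointName σ) (g : Fin k' → StateName σ) :
    Forces σ (.eqPoint i j) (Subtype.val ∘ f) (Subtype.val ∘ g) ↔ EqPointName σ (f i) (f j) := by
  constructor
  · rintro ⟨N, hr, h⟩
    exact ⟨N, ⟨Fin.forall_fin_two.2 ⟨hr.1 i, hr.1 j⟩, fun l => l.elim0⟩, h⟩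
  · rintro ⟨N, h⟩
    obtain ⟨M, hM⟩ := exists_inRange hσ.mono f g
    exact ⟨max N M, hM.mono (hσ.mono (le_max_right _ _)),
      (h.mono (hσ.mono (le_max_left _ _))).2⟩

theorem forces_eqState (i j : Fin k') (f : Fin k → PointName σ) (g : Fin k' → StateName σ) :
    Forces σ (.eqState i j) (Subtype.val ∘ f) (Subtype.val ∘ g) ↔ EqStateName σ (g i) (g j) := by
  constructor
  · rintro ⟨N, hr, h⟩
    exact ⟨N, ⟨fun l => l.elim0, Fin.forall_fin_two.2 ⟨hr.2 i, hr.2 j⟩⟩, h⟩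
  · rintro ⟨N, h⟩
    obtain ⟨M, hM⟩ := exists_inRange hσ.mono f g
    exact ⟨max N M, hM.mono (hσ.mono (le_max_right _ _)),
      (h.mono (hσ.mono (le_max_left _ _))).2⟩

theorem forces_rel (i : Fin k) (j : Fin k') (f : Fin k → PointName σ) (g : Fin k' → StateName σ) :
    Forces σ (.rel i j) (Subtype.val ∘ f) (Subtype.val ∘ g) ↔ RelName σ (f i) (g j) := by
  constructor
  · rintro ⟨N, hr, h⟩
    exact ⟨N, ⟨fun _ => by simpa using hr.1 i, fun _ => by simpa using hr.2 j⟩, h⟩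
  · rintro ⟨N, h⟩
    obtain ⟨M, hM⟩ := exists_inRange hσ.mono f g
    exact ⟨max N M, hM.mono (hσ.mono (le_max_right _ _)),
      (h.mono (hσ.mono (le_max_left _ _))).2⟩

theorem equivalence_point : Equivalence fun i j : PointName σ => EqPointName σ i j where
  refl i := (hσ.forces_eqPoint 0 0 ![i] Fin.elim0).1 <|
    hσ.forces_of_imp (n := 0) (φ := Fin.elim0) (fun l => l.elim0) fun _ _ _ _ => rfl
  symm {i j} h := (hσ.forces_eqPoint 1 0 ![i, j] Fin.elim0).1 <|
    hσ.forces_of_imp (n := 1) (φ := fun _ => .eqPoint 0 1)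
      (fun _ => (hσ.forces_eqPoint 0 1 ![i, j] Fin.elim0).2 h) fun _ _ _ h => (h 0).symm
  trans {i j l} h h' := (hσ.forces_eqPoint 0 2 ![i, j, l] Fin.elim0).1 <|
    hσ.forces_of_imp (n := 2) (φ := ![.eqPoint 0 1, .eqPoint 1 2])
      (Fin.forall_fin_two.2 ⟨(hσ.forces_eqPoint 0 1 ![i, j, l] Fin.elim0).2 h,
        (hσ.forces_eqPoint 1 2 ![i, j, l] Fin.elim0).2 h'⟩) fun _ _ _ h => (h 0).trans (h 1)

theorem equivalence_state : Equivalence fun i j : StateName σ => EqStateName σ i j where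
  refl i := (hσ.forces_eqState 0 0 Fin.elim0 ![i]).1 <|
    hσ.forces_of_imp (n := 0) (φ := Fin.elim0) (fun l => l.elim0) fun _ _ _ _ => rfl
  symm {i j} h := (hσ.forces_eqState 1 0 Fin.elim0 ![i, j]).1 <|
    hσ.forces_of_imp (n := 1) (φ := fun _ => .eqState 0 1)
      (fun _ => (hσ.forces_eqState 0 1 Fin.elim0 ![i, j]).2 h) fun _ _ _ h => (h 0).symm
  trans {i j l} h h' := (hσ.forces_eqState 0 2 Fin.elim0 ![i, j, l]).1 <|
    hσ.forces_of_imp (n := 2) (φ := ![.eqState 0 1, .eqState 1 2])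
      (Fin.forall_fin_two.2 ⟨(hσ.forces_eqState 0 1 Fin.elim0 ![i, j, l]).2 h,
        (hσ.forces_eqState 1 2 Fin.elim0 ![i, j, l]).2 h'⟩) fun _ _ _ h => (h 0).trans (h 1)

theorem relName_congr {i i' : PointName σ} {j j' : StateName σ} (hi : EqPointName σ i i')
    (hj : EqStateName σ j j') (h : RelName σ i j) : RelName σ i' j' := by
  refine (hσ.forces_rel 1 1 ![i, i'] ![j, j']).1 <|
    hσ.forces_of_imp (n := 3) (φ := ![.eqPoint 0 1, .eqState 0 1, .rel 0 0]) ?_ ?_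
  · intro l
    fin_cases l
    exacts [(hσ.forces_eqPoint 0 1 ![i, i'] ![j, j']).2 hi,
      (hσ.forces_eqState 0 1 ![i, i'] ![j, j']).2 hj, (hσ.forces_rel 0 0 ![i, i'] ![j, j']).2 h]
  · intro C x a h
    have h₀ : x 0 = x 1 := h 0
    have h₁ : a 0 = a 1 := h 1
    have h₂ : C.rel (x 0) (a 0) := h 2
    rw [h₀, h₁] at h₂
    exact h₂

/-- A Chu space whose elements are named, with atomic formulas true exactly if forced, satisfies
exactly the forced formulas. -/
theorem forces_iff_realize {E : ChuSpace.{u}} {pt : PointName σ → E.Point}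
    {st : StateName σ → E.State} (hpt : pt.Surjective) (hst : st.Surjective)
    (eqPoint : ∀ i j : PointName σ, EqPointName σ i j ↔ pt i = pt j)
    (eqState : ∀ i j : StateName σ, EqStateName σ i j ↔ st i = st j)
    (rel : ∀ (i : PointName σ) (j : StateName σ), RelName σ i j ↔ E.rel (pt i) (st j)) (ψ : Formula k k')
    (f : Fin k → PointName σ) (g : Fin k' → StateName σ) :
    Forces σ ψ (Subtype.val ∘ f) (Subtype.val ∘ g) ↔ ψ.Realize E (pt ∘ f) (st ∘ g) := by
  induction ψ with
  | eqPoint i j => rw [hσ.forces_eqPoint, eqPoint]; rfl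
  | eqState i j => rw [hσ.forces_eqState, eqState]; rfl
  | rel i j => rw [hσ.forces_rel, rel]; rfl
  | neg ψ ih => rw [hσ.forces_neg, ih]; rfl
  | conj ψ ih => rw [hσ.forces_conj]; exact forall_congr' fun l => ih l f g
  | disj ψ ih => rw [hσ.forces_disj]; exact exists_congr fun l => ih l f g
  | exPoint ψ ih =>
    rw [hσ.forces_exPoint]
    simp only [ih]
    simp only [Fin.comp_snoc, Formula.Realize, hpt.exists]
  | exState ψ ih =>
    rw [hσ.forces_exState]
    simp only [ih]
    simp only [Fin.comp_snoc, Formula.Realize, hst.exists]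
  | allPoint ψ ih =>
    rw [hσ.forces_congr (ψ := .neg (.exPoint (.neg ψ))) f g (by simp [Formula.Realize]),
      hσ.forces_neg, hσ.forces_exPoint]
    simp only [hσ.forces_neg, ih]
    simp only [Fin.comp_snoc, Formula.Realize, hpt.forall, not_exists, not_not]
  | allState ψ ih =>
    rw [hσ.forces_congr (ψ := .neg (.exState (.neg ψ))) f g (by simp [Formula.Realize]),
      hσ.forces_neg, hσ.forces_exState]
    simp only [hσ.forces_neg, ih]
    simp only [Fin.comp_snoc, Formula.Realize, hst.forall, not_exists, not_not]

end IsGeneric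

end Chu

/-! ### Term models and the resulting restriction -/

namespace Chu

theorem Sentence.holdsIn_iff (φ : Sentence) {C : ChuSpace.{u}} (x : Fin 0 → C.Point)
    (a : Fin 0 → C.State) : φ.HoldsIn C ↔ Formula.Realize C φ x a := by
  rw [Subsingleton.elim x Fin.elim0, Subsingleton.elim a Fin.elim0]
  rfl

namespace IsGeneric

variable {σ : ℕ → PointedClass.{u}} (hσ : IsGeneric σ)

/-- The names of points up to forced equality. -/
def pointSetoid : Setoid (PointName σ) := ⟨_, hσ.equivalence_point⟩

/-- The names of states up to forced equality. -/
def stateSetoid : Setoid (StateName σ) := ⟨_, hσ.equivalence_state⟩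

/-- The Chu space of names modulo forced equality. -/
def termSpace : ChuSpace.{u} where
  -- Names form types in the lowest universe and are lifted to the universe of the Chu spaces.
  Point := ULift (Quotient hσ.pointSetoid)
  State := ULift (Quotient hσ.stateSetoid)
  rel q s := ∃ i j, Quotient.mk hσ.pointSetoid i = q.down ∧ Quotient.mk hσ.stateSetoid j = s.down ∧
    RelName σ i j

/-- The point with a given name. -/
def point (i : PointName σ) : hσ.termSpace.Point := ⟨Quotient.mk hσ.pointSetoid i⟩

/-- The state with a given name. -/
def state (j : StateName σ) : hσ.termSpace.State := ⟨Quotient.mk hσ.stateSetoid j⟩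

theorem point_surjective : hσ.point.Surjective := fun ⟨q⟩ =>
  q.inductionOn fun i => ⟨i, rfl⟩

theorem state_surjective : hσ.state.Surjective := fun ⟨q⟩ =>
  q.inductionOn fun i => ⟨i, rfl⟩

theorem eqPointName_iff (i j : PointName σ) : EqPointName σ i j ↔ hσ.point i = hσ.point j :=
  ⟨fun h => congrArg ULift.up (Quotient.sound (s := hσ.pointSetoid) h),
    fun h => Quotient.exact (s := hσ.pointSetoid) (congrArg ULift.down h)⟩

theorem eqStateName_iff (i j : StateName σ) : EqStateName σ i j ↔ hσ.state i = hσ.state j :=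
  ⟨fun h => congrArg ULift.up (Quotient.sound (s := hσ.stateSetoid) h),
    fun h => Quotient.exact (s := hσ.stateSetoid) (congrArg ULift.down h)⟩

theorem relName_iff (i : PointName σ) (j : StateName σ) :
    RelName σ i j ↔ hσ.termSpace.rel (hσ.point i) (hσ.state j) :=
  ⟨fun h => ⟨i, j, rfl, rfl, h⟩, fun ⟨_, _, hi, hj, h⟩ =>
    hσ.relName_congr (Quotient.exact (s := hσ.pointSetoid) hi)
      (Quotient.exact (s := hσ.stateSetoid) hj) h⟩

end IsGeneric

/-- Every change of variables in `α` results in a formula equivalent to a regressive-flow one. -/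
def Formula.IsFlowLiteral {k k' : ℕ} (α : Formula k k') : Prop :=
  ∀ {m n : ℕ} (f : Fin k → Fin m) (g : Fin k' → Fin n), ∃ θ : Formula m n, θ.IsRegressiveFlow ∧
    ∀ (C : ChuSpace.{u}) x a, θ.Realize C x a ↔ α.Realize C (x ∘ f) (a ∘ g)

theorem ValidIndex.exists_lookup_eq {n : ℕ} {j : ℕ ⊕ ℕ} (h : ValidIndex n 0 j) :
    ∃ i : Fin n, ∀ {α : Type u} {l : ℕ} (a : Fin n → α) (c : Fin l → α) (h : ValidIndex n l j),
      lookup a c j h = a i := by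
  cases j with
  | inl j => exact ⟨⟨j, h⟩, fun _ _ _ => rfl⟩
  | inr j => exact (Nat.not_lt_zero _ h).elim

/-- Names that are valid on the right are shared, so `α` can be rewritten as a regressive-flow
formula in the distinguished elements of the condition. It would separate the two classes. -/
theorem Condition.not_holds_neg (p : Condition.{u}) {k k' : ℕ} {α : Formula k k'}
    (hα : Formula.IsFlowLiteral.{u} α) {f : Fin k → ℕ} {g : Fin k' → ℕ ⊕ ℕ}
    (hl : (p.side true).Holds α f g) : ¬ (p.side false).Holds α.neg f g := by
  rintro ⟨hr', hn⟩
  obtain ⟨hr, hl⟩ := hl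
  have hv (j) : ValidIndex p.states 0 (g j) := hr'.2 j
  choose g₀ hg₀ using fun j => (hv j).exists_lookup_eq
  obtain ⟨θ, hθ, h⟩ := hα (fun i => (⟨f i, hr.1 i⟩ : Fin p.points)) g₀
  refine p.inseparable θ hθ (fun C x a c hx => (h C x a).2 ?_)
    fun C x a c hx hh => hn C x a c hx ?_
  · have e : a ∘ g₀ = fun j => lookup a c (g j) (hr.2 j) := funext fun j => (hg₀ j a c _).symm
    exact (congrArg (α.Realize C _) e).mpr (hl C x a c hx)
  · have e : (fun j => lookup a c (g j) (hr'.2 j)) = a ∘ g₀ := funext fun j => hg₀ j a c _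
    exact (congrArg (α.Realize C _) e).mpr ((h C x a).1 hh)

section Sequence

variable {s : ℕ → Condition.{u}} (hs : Monotone s) (hg : ∀ b, IsGeneric fun N => (s N).side b)

/-- A right name of a state is also a left one. -/
def StateName.toLeft (j : StateName fun N => (s N).side false) :
    StateName fun N => (s N).side true :=
  ⟨j.1, j.2.imp fun _ h => h.mono le_rfl (Nat.zero_le _)⟩

include hs hg

/-- Inseparability only carries truth from left to right. Applied to `α` and to its negation, it
gives agreement, since each side is complete. -/
theorem forces_left_iff_right {k k' : ℕ} {α : Formula k k'} (hα : Formula.IsFlowLiteral.{u} α)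
    (hα' : Formula.IsFlowLiteral.{u} α.neg) (f : Fin k → PointName fun N => (s N).side false)
    (g : Fin k' → StateName fun N => (s N).side false) :
    Forces (fun N => (s N).side true) α (Subtype.val ∘ f) (Subtype.val ∘ g) ↔
      Forces (fun N => (s N).side false) α (Subtype.val ∘ f) (Subtype.val ∘ g) := by
  have key {β : Formula k k'} (hβ : Formula.IsFlowLiteral.{u} β)
      (h : Forces (fun N => (s N).side true) β (Subtype.val ∘ f) (Subtype.val ∘ g)) :
      ¬ Forces (fun N => (s N).side false) β.neg (Subtype.val ∘ f) (Subtype.val ∘ g) := by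
    rintro ⟨M, hM⟩
    obtain ⟨N, hN⟩ := h
    exact (s (max N M)).not_holds_neg hβ (hN.mono (hs (le_max_left _ _) _))
      (hM.mono (hs (le_max_right _ _) _))
  constructor
  · intro h
    by_contra hn
    exact key hα h (((hg false).forces_neg α f g).2 hn)
  · intro h
    by_contra hn
    refine key hα' (((hg true).forces_neg α f (StateName.toLeft ∘ g)).2 hn) ?_
    rw [(hg false).forces_neg, (hg false).forces_neg]
    exact fun h' => h' h

/-- A generic sequence of conditions yields a restriction of Chu spaces whose domain satisfies what
the left classes force and whose codomain satisfies what the right classes force. -/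
theorem exists_realize_restrict : ∃ (C : ChuSpace.{u}) (B : Set C.State),
    (∀ (ψ : Sentence) f g, Forces (fun N => (s N).side true) ψ f g → ψ.HoldsIn C) ∧
    ∀ (ψ : Sentence) f g, Forces (fun N => (s N).side false) ψ f g → ψ.HoldsIn (C.restrict B) := by
  -- The restriction keeps the states that have a shared name. Point names are the same on both
  -- sides, so the left naming of points also serves the right.
  let st (j : StateName fun N => (s N).side false) : (hg true).termSpace.State :=
    (hg true).state j.toLeft
  let st' (j : StateName fun N => (s N).side false) : Set.range st := ⟨st j, j, rfl⟩
  refine ⟨(hg true).termSpace, Set.range st, fun ψ f g h => ?_, fun ψ f g h => ?_⟩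
  · rw [Subsingleton.elim f (Subtype.val ∘ Fin.elim0),
      Subsingleton.elim g (Subtype.val ∘ Fin.elim0)] at h
    exact (ψ.holdsIn_iff _ _).2 <| ((hg true).forces_iff_realize (hg true).point_surjective
      (hg true).state_surjective (hg true).eqPointName_iff (hg true).eqStateName_iff
      (hg true).relName_iff ψ Fin.elim0 Fin.elim0).1 h
  · rw [Subsingleton.elim f (Subtype.val ∘ Fin.elim0),
      Subsingleton.elim g (Subtype.val ∘ Fin.elim0)] at h
    -- The truth lemma for the right side is applied to the restricted left term space: its atomic
    -- hypotheses hold because the sides agree on literals.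
    refine (ψ.holdsIn_iff _ _).2 <| ((hg false).forces_iff_realize
      (E := (hg true).termSpace.restrict (Set.range st)) (pt := (hg true).point) (st := st')
      (hg true).point_surjective ?_ ?_ ?_ ?_ ψ Fin.elim0 Fin.elim0).1 h
    · rintro ⟨_, j, rfl⟩
      exact ⟨j, rfl⟩
    · intro i j
      refine ((hg false).forces_eqPoint 0 1 ![i, j] Fin.elim0).symm.trans <| (forces_left_iff_right hs hg
        (fun f g => ⟨_, .eqPoint (f 0) (f 1), fun _ _ _ => .rfl⟩)
        (fun f g => ⟨_, .negEqPoint (f 0) (f 1), fun _ _ _ => .rfl⟩) _ _).symm.trans ?_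
      exact ((hg true).forces_eqPoint 0 1 ![i, j] (StateName.toLeft ∘ Fin.elim0)).trans
        ((hg true).eqPointName_iff i j)
    · intro i j
      refine ((hg false).forces_eqState 0 1 Fin.elim0 ![i, j]).symm.trans <| (forces_left_iff_right hs hg
        (fun f g => ⟨_, .eqState (g 0) (g 1), fun _ _ _ => .rfl⟩)
        (fun f g => ⟨_, .negEqState (g 0) (g 1), fun _ _ _ => .rfl⟩) _ _).symm.trans ?_
      exact (((hg true).forces_eqState 0 1 Fin.elim0 (StateName.toLeft ∘ ![i, j])).trans
        ((hg true).eqStateName_iff i.toLeft j.toLeft)).trans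
        (Subtype.ext_iff (a1 := st' i) (a2 := st' j)).symm
    · intro i j
      refine ((hg false).forces_rel 0 0 ![i] ![j]).symm.trans <| (forces_left_iff_right hs hg
        (fun f g => ⟨_, .rel (f 0) (g 0), fun _ _ _ => .rfl⟩)
        (fun f g => ⟨_, .negRel (f 0) (g 0), fun _ _ _ => .rfl⟩) _ _).symm.trans ?_
      exact ((hg true).forces_rel 0 0 ![i] (StateName.toLeft ∘ ![j])).trans
        ((hg true).relName_iff i j.toLeft)

end Sequence

/-- A regressive sentence is separated from its negation by a regressive-flow sentence. -/
theorem Sentence.exists_flow_separator {φ : Sentence} (hφ : IsRegressive.{u} φ) :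
    ∃ θ : Sentence, θ.IsRegressiveFlow ∧ (∀ C : ChuSpace.{u}, φ.HoldsIn C → θ.HoldsIn C) ∧
      ∀ C : ChuSpace.{u}, ¬ φ.HoldsIn C → ¬ θ.HoldsIn C := by
  by_contra! hsep
  -- With no names yet, inseparability of the spaces satisfying `φ` from those violating it is
  -- exactly the assumption that no separator exists.
  let p : Condition.{u} := ⟨0, 0, 0, fun C _ _ _ => φ.HoldsIn C, fun C _ _ _ => ¬ φ.HoldsIn C, by
    intro θ hθ l n
    obtain ⟨C, hC, hC'⟩ := hsep θ hθ fun C hC => l C _ _ Fin.elim0 hC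
    exact n C _ _ Fin.elim0 hC hC'⟩
  obtain ⟨s, hs, h0, hg⟩ := p.exists_generic
  obtain ⟨C, B, hl, hr⟩ := exists_realize_restrict hs hg
  have hl' : (p.side true).Holds φ Fin.elim0 Fin.elim0 :=
    ⟨⟨fun i => i.elim0, fun j => j.elim0⟩, fun C _ _ _ h => (φ.holdsIn_iff _ _).1 h⟩
  have hr' : (p.side false).Holds φ.neg Fin.elim0 Fin.elim0 :=
    ⟨⟨fun i => i.elim0, fun j => j.elim0⟩, fun C _ _ _ h h' => h ((φ.holdsIn_iff _ _).2 h')⟩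
  rw [← h0] at hl' hr'
  exact hr _ _ _ ⟨0, hr'⟩ <| (φ.holdsIn_iff _ _).1 <| (φ.holdsIn_iff _ _).2 <|
    hφ C _ _ (.restrict C B) Fin.elim0 Fin.elim0 <| (φ.holdsIn_iff _ _).1 (hl _ _ _ ⟨0, hl'⟩)

end Chu

theorem mainTheorem4 (φ : Chu.Sentence) :
    Chu.Sentence.IsRegressive.{u} φ ↔
      ∃ θ : Chu.Sentence, Chu.Formula.IsRegressiveFlow θ ∧
        Chu.Sentence.LogicallyEquivalent.{u} φ θ := by
  constructor
  · intro hφ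
    obtain ⟨θ, hθ, h, h'⟩ := Chu.Sentence.exists_flow_separator hφ
    exact ⟨θ, hθ, fun C => ⟨h C, fun hC => by_contra fun hn => h' C hn hC⟩⟩
  · rintro ⟨θ, hθ, heq⟩ C _ _ ht x b hx
    cases ht with | restrict B =>
    refine (φ.holdsIn_iff _ _).1 <| (heq _).2 <| (θ.holdsIn_iff (C := C.restrict B) x b).2 <|
      hθ.realize_restrict B _ _ ?_
    exact (θ.holdsIn_iff _ _).1 <| (heq C).1 <| (φ.holdsIn_iff _ _).2 hx
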